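/- **The game.** Fix a number of rounds $n$. A buyer has a private value $v\in[0,1]$, drawn once from a distribution $F$ known to the seller and the same in all rounds. In each round the seller posts a price $p\ge 0$ for a fresh item (production cost $0$) and the buyer then accepts or rejects. *Partial commitment*: the seller may never post a price larger than a price that the buyer has accepted in an earlier round; he may lower prices. The buyer's utility is the sum of $v-p$ over the rounds in which he accepts, the seller's utility is the sum of the accepted prices; there is no discounting. A history consists of all past prices and responses and satisfies the above constraints. A seller strategy $\sigma_s$ assigns (measurably) to every history a probability distribution over the allowed prices; a buyer strategy $\sigma_b$ assigns (measurably) to every value $v$, history $h$ and newly posted price $p$ a probability of acceptance. A belief system $\mu$ assigns to every history a probability distribution on $[0,1]$, the seller's belief about $v$; it does not change when the seller posts a price. **Perfect Bayesian equilibrium (PBE).** $(\sigma_s,\sigma_b,\mu)$ is a PBE if 1. the initial belief is $F$, and after every history $h$, every allowed price $p$ and every response to $p$ that has positive probability under $\mu(\cdot\mid h)$ and $\sigma_b$, the new belief is obtained from $\mu(\cdot\mid h)$ by Bayes' rule (after responses of probability zero the new belief is unrestricted); 2. after every history, both at the beginning of a round and after a price has been posted, $\sigma_s$ maximizes the seller's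 expected utility from then on against $\sigma_b$, with $v$ distributed according to the current belief, among all seller strategies; and for every value $v\in[0,1]$, $\sigma_b$ maximizes the expected utility from then on of the buyer of value $v$ against $\sigma_s$, among all buyer strategies. It is a *threshold* PBE if there is a deterministic threshold $t(h,p)\ge 0$ for every history $h$ and allowed price $p$ such that under $\sigma_b$ the buyer of value $v$ accepts $p$ after $h$ if $v\ge t(h,p)$ and rejects otherwise. **Theorem.** For every integer $k\ge 0$ and every number of rounds $n$, the $n$-round partial commitment repeated sales game in which the buyer's value has density $f(x)=(k+1)x^k$ on $[0,1]$ has a threshold PBE. -/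

import Mathlib

open MeasureTheory ProbabilityTheory
open scoped ENNReal

noncomputable section

namespace RepeatedSales

/-- A history of `r` completed rounds. Entry `i` is the price posted in round `i` together with
the buyer's response (`true` = accept, `false` = reject). -/
abbrev Hist (r : ℕ) : Type := Fin r → ℝ × Bool

/-- Append one more round (posted price and response) to a history. -/
def Hist.extend {r : ℕ} (h : Hist r) (p : ℝ) (a : Bool) : Hist (r + 1) :=
  Fin.snoc (α := fun _ => ℝ × Bool) h (p, a)

/-- The prices the seller may post after history `h`: nonnegative prices which, by the partial
commitment, do not exceed any price that the buyer has accepted so far. -/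
def Hist.allowed {r : ℕ} (h : Hist r) : Set ℝ :=
  {p | 0 ≤ p ∧ ∀ j, (h j).2 = true → p ≤ (h j).1}

/-- `h` is a history of the partial commitment game: every price in it was allowed when it
was posted. -/
def Hist.Feasible {r : ℕ} (h : Hist r) : Prop :=
  ∀ i, 0 ≤ (h i).1 ∧ ∀ j, j < i → (h j).2 = true → (h i).1 ≤ (h j).1

/-- The set of possible private values of the buyer. -/
def valueSpace : Set ℝ := Set.Icc 0 1

/-- The power law distribution on `[0,1]` with density `(k + 1) x ^ k`. -/
def powerLaw (k : ℕ) : Measure ℝ :=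
  (volume.restrict (Set.Icc 0 1)).withDensity fun x => ENNReal.ofReal ((k + 1) * x ^ k)

/-- A (behavioral) strategy of the seller: after every history, a probability distribution over
the allowed prices, depending measurably on the history. -/
structure SellerStrategy where
  price : ∀ r : ℕ, Kernel (Hist r) ℝ
  isMarkov : ∀ r, IsMarkovKernel (price r)
  allowed : ∀ r (h : Hist r), h.Feasible → ∀ᵐ p ∂(price r h), p ∈ h.allowed

/-- A (behavioral) strategy of the buyer: `accept r v h p` is the probability with which a buyer
of value `v` accepts the price `p` posted after the history `h` of `r` rounds. -/
structure BuyerStrategy where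
  accept : ∀ r : ℕ, ℝ → Hist r → ℝ → ℝ≥0∞
  accept_le_one : ∀ r v h p, accept r v h p ≤ 1
  measurable_accept : ∀ r,
    Measurable fun x : ℝ × Hist r × ℝ => accept r x.1 x.2.1 x.2.2

/-- Probability that a buyer of value `v` responds with `a` to the price `p`. -/
def BuyerStrategy.respond (b : BuyerStrategy) (r : ℕ) (v : ℝ) (h : Hist r) (p : ℝ) :
    Bool → ℝ≥0∞
  | true => b.accept r v h p
  | false => 1 - b.accept r v h p

/-- Expectation of the sum of `g (price)` over those of the next `m` rounds in which the buyer
accepts, when the history so far is `h`, the buyer has value `v`, and the play follows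
`(s, b)`. -/
def expTotal (g : ℝ → ℝ≥0∞) (s : SellerStrategy) (b : BuyerStrategy) (v : ℝ) :
    (m r : ℕ) → Hist r → ℝ≥0∞
  | 0, _, _ => 0
  | m + 1, r, h =>
    ∫⁻ p, (b.respond r v h p true * (g p + expTotal g s b v m (r + 1) (h.extend p true))
      + b.respond r v h p false * expTotal g s b v m (r + 1) (h.extend p false)) ∂(s.price r h)

/-- The same expectation when the current price `p` has already been posted, the buyer is about
to respond, and `m` further rounds follow the current one. -/
def expTotalAt (g : ℝ → ℝ≥0∞) (s : SellerStrategy) (b : BuyerStrategy) (v : ℝ)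
    (m r : ℕ) (h : Hist r) (p : ℝ) : ℝ≥0∞ :=
  b.respond r v h p true * (g p + expTotal g s b v m (r + 1) (h.extend p true))
    + b.respond r v h p false * expTotal g s b v m (r + 1) (h.extend p false)

/-- The seller's expected utility (revenue) from the remaining `m` rounds after history `h`,
when his belief about the buyer's value is `μ`. -/
def sellerUtility (s : SellerStrategy) (b : BuyerStrategy) (μ : Measure ℝ)
    (m r : ℕ) (h : Hist r) : ℝ≥0∞ :=
  ∫⁻ v, expTotal ENNReal.ofReal s b v m r h ∂μ

/-- The seller's expected utility from the current round, in which `p` has just been posted,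
and the `m` rounds following it. -/
def sellerUtilityAt (s : SellerStrategy) (b : BuyerStrategy) (μ : Measure ℝ)
    (m r : ℕ) (h : Hist r) (p : ℝ) : ℝ≥0∞ :=
  ∫⁻ v, expTotalAt ENNReal.ofReal s b v m r h p ∂μ

/-- The expected utility of a buyer of value `v ≥ 0` from the remaining `m` rounds after history
`h`: `v` times the expected number of purchases minus the expected payment. The former is finite,
so the difference is a genuine element of `[-∞, ∞)`. -/
def buyerUtility (s : SellerStrategy) (b : BuyerStrategy) (v : ℝ)
    (m r : ℕ) (h : Hist r) : EReal :=
  ((ENNReal.ofReal v * expTotal (fun _ => 1) s b v m r h : ℝ≥0∞) : EReal)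
    - (expTotal ENNReal.ofReal s b v m r h : EReal)

/-- The expected utility of a buyer of value `v ≥ 0` from the current round, in which `p` has
just been posted, and the `m` rounds following it. -/
def buyerUtilityAt (s : SellerStrategy) (b : BuyerStrategy) (v : ℝ)
    (m r : ℕ) (h : Hist r) (p : ℝ) : EReal :=
  ((ENNReal.ofReal v * expTotalAt (fun _ => 1) s b v m r h p : ℝ≥0∞) : EReal)
    - (expTotalAt ENNReal.ofReal s b v m r h p : EReal)

/-- `(s, b)` with the seller's beliefs `μ` is a perfect Bayesian equilibrium of the `n` rounds
partial commitment repeated sales game in which the buyer's value is drawn from `F`. The seller's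
belief after `h` is `μ r h`; it does not change when he posts a price himself. -/
structure IsPBE (n : ℕ) (F : Measure ℝ) (s : SellerStrategy) (b : BuyerStrategy)
    (μ : ∀ r : ℕ, Hist r → Measure ℝ) : Prop where
  /-- Beliefs are probability distributions over the possible values. -/
  belief_prob : ∀ r ≤ n, ∀ h : Hist r, h.Feasible → IsProbabilityMeasure (μ r h)
  belief_support : ∀ r ≤ n, ∀ h : Hist r, h.Feasible → ∀ᵐ v ∂(μ r h), v ∈ valueSpace
  /-- Before the first round the belief is the prior. -/
  prior : ∀ h : Hist 0, μ 0 h = F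
  /-- Bayes' rule after the response `a` to any price `p`, on or off the path of play. It says
  nothing when the response has probability zero under the current belief. -/
  bayes : ∀ r < n, ∀ h : Hist r, h.Feasible → ∀ p ∈ h.allowed, ∀ a : Bool,
    ∀ B : Set ℝ, MeasurableSet B →
      μ (r + 1) (h.extend p a) B * ∫⁻ v, b.respond r v h p a ∂(μ r h)
        = ∫⁻ v in B, b.respond r v h p a ∂(μ r h)
  /-- The seller best-responds at the beginning of a round, after every history. -/
  seller_opt : ∀ r m, r + m = n → ∀ h : Hist r, h.Feasible → ∀ s' : SellerStrategy,
    sellerUtility s' b (μ r h) m r h ≤ sellerUtility s b (μ r h) m r h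
  /-- The seller's continuation is a best response after every posted price. -/
  seller_opt_at : ∀ r m, r + (m + 1) = n → ∀ h : Hist r, h.Feasible → ∀ p ∈ h.allowed,
    ∀ s' : SellerStrategy,
      sellerUtilityAt s' b (μ r h) m r h p ≤ sellerUtilityAt s b (μ r h) m r h p
  /-- Every type of the buyer best-responds from the beginning of a round, after every
  history. -/
  buyer_opt : ∀ r m, r + m = n → ∀ h : Hist r, h.Feasible → ∀ v ∈ valueSpace,
    ∀ b' : BuyerStrategy, buyerUtility s b' v m r h ≤ buyerUtility s b v m r h
  /-- Every type of the buyer best-responds after every posted price. -/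
  buyer_opt_at : ∀ r m, r + (m + 1) = n → ∀ h : Hist r, h.Feasible → ∀ p ∈ h.allowed,
    ∀ v ∈ valueSpace, ∀ b' : BuyerStrategy,
      buyerUtilityAt s b' v m r h p ≤ buyerUtilityAt s b v m r h p

open Classical in
/-- In an `n` rounds game, `b` is a threshold strategy: there is a deterministic nonnegative
threshold, depending on the history including the current price, and a buyer of value `v`
accepts exactly when `v` is at least the threshold. -/
def BuyerStrategy.IsThreshold (b : BuyerStrategy) (n : ℕ) : Prop :=
  ∃ t : ∀ r : ℕ, Hist r → ℝ → ℝ,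
    ∀ r < n, ∀ h : Hist r, h.Feasible → ∀ p ∈ h.allowed,
      0 ≤ t r h p ∧
        ∀ v ∈ valueSpace, b.accept r v h p = if t r h p ≤ v then 1 else 0

end RepeatedSales

end

/-! The seller's strategy is scale invariant. As long as nothing has been sold, his belief is the
prior conditioned on a value below some `a`. For a prior with distribution function `x ^ α` this is
a copy of the prior scaled by `a`, so he posts a price proportional to `a` and expects a revenue
proportional to `a`. After the first sale he keeps posting the least price accepted so far.

A buyer who accepts `p` for the first time when `j` rounds follow gets `j + 1` items for `p` each.
His threshold `θ` is the value at which this is as good as rejecting. After a rejection the seller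
believes that the value is below `min a θ`, so the buyer of value `θ` buys in all the later rounds
and pays `w * min a θ` in total, where `w` only depends on `j`. Hence
`θ + w * min a θ = (j + 1) * p`. As a function of the value, the utility after a rejection grows at
rate at most `j`, which is what makes the buyers above `θ` accept and those below it reject.

Choosing a price is then the same as choosing `θ / a`, and the seller chooses a maximizer of his
revenue. That nobody gains from a deviation follows from the Bellman equations, one round at a
time.
-/

namespace RepeatedSales

noncomputable section

section Histories

variable {r : ℕ}

theorem Hist.Feasible.init {h : Hist (r + 1)} (hf : h.Feasible) :
    Hist.Feasible (r := r) (Fin.init h) :=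
  fun i => ⟨(hf i.castSucc).1, fun j hj => (hf i.castSucc).2 j.castSucc (by simpa using hj)⟩

theorem Hist.Feasible.extend {h : Hist r} (hf : h.Feasible) {p : ℝ} (hp : p ∈ h.allowed)
    (a : Bool) : (h.extend p a).Feasible := by
  intro i
  induction i using Fin.lastCases with
  | last =>
    refine ⟨by simpa [Hist.extend] using hp.1, fun j hj => ?_⟩
    induction j using Fin.lastCases with
    | last => exact absurd hj (lt_irrefl _)
    | cast j => simpa [Hist.extend] using hp.2 j
  | cast i =>
    refine ⟨by simpa [Hist.extend] using (hf i).1, fun j hj => ?_⟩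
    induction j using Fin.lastCases with
    | last => exact absurd hj (not_lt.2 (Fin.le_last _))
    | cast j => simpa [Hist.extend] using (hf i).2 j (by simpa using hj)

theorem measurable_extend (r : ℕ) (a : Bool) :
    Measurable fun x : Hist r × ℝ => x.1.extend x.2 a := by
  refine measurable_pi_lambda _ fun i => ?_
  induction i using Fin.lastCases with
  | last =>
    simp only [Hist.extend, Fin.snoc_last]
    fun_prop
  | cast i =>
    simp only [Hist.extend, Fin.snoc_castSucc]
    fun_prop

end Histories

section ExpectedTotals

variable (s : SellerStrategy) (b : BuyerStrategy)

theorem BuyerStrategy.measurable_respond (r : ℕ) (a : Bool) :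
    Measurable fun x : ℝ × Hist r × ℝ => b.respond r x.1 x.2.1 x.2.2 a := by
  cases a
  · exact measurable_const.sub (b.measurable_accept r)
  · exact b.measurable_accept r

theorem BuyerStrategy.respond_true_add_respond_false (r : ℕ) (v : ℝ) (h : Hist r) (p : ℝ) :
    b.respond r v h p true + b.respond r v h p false = 1 :=
  add_tsub_cancel_of_le (b.accept_le_one r v h p)

theorem expTotal_succ (g : ℝ → ℝ≥0∞) (v : ℝ) (m r : ℕ) (h : Hist r) :
    expTotal g s b v (m + 1) r h = ∫⁻ p, expTotalAt g s b v m r h p ∂(s.price r h) :=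
  rfl

theorem measurable_expTotalAt_of_measurable_expTotal {g : ℝ → ℝ≥0∞} (hg : Measurable g) {m r : ℕ}
    (h : Measurable fun x : ℝ × Hist (r + 1) => expTotal g s b x.1 m (r + 1) x.2) :
    Measurable fun x : ℝ × Hist r × ℝ => expTotalAt g s b x.1 m r x.2.1 x.2.2 := by
  have htotal (a : Bool) : Measurable fun x : ℝ × Hist r × ℝ =>
      expTotal g s b x.1 m (r + 1) (x.2.1.extend x.2.2 a) :=
    h.comp (measurable_fst.prodMk ((measurable_extend r a).comp measurable_snd))
  exact ((b.measurable_respond r true).mul ((hg.comp (by fun_prop)).add (htotal true))).add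
    ((b.measurable_respond r false).mul (htotal false))

theorem measurable_expTotal {g : ℝ → ℝ≥0∞} (hg : Measurable g) (m r : ℕ) :
    Measurable fun x : ℝ × Hist r => expTotal g s b x.1 m r x.2 := by
  induction m generalizing r with
  | zero => exact measurable_const
  | succ m ih =>
    have := s.isMarkov r
    have hAt := measurable_expTotalAt_of_measurable_expTotal s b hg (ih (r + 1))
    exact Measurable.lintegral_kernel_prod_right'
      (κ := (s.price r).comap Prod.snd measurable_snd)
      (f := fun x : (ℝ × Hist r) × ℝ => expTotalAt g s b x.1.1 m r x.1.2 x.2)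
      (hAt.comp (by fun_prop : Measurable fun x : (ℝ × Hist r) × ℝ => (x.1.1, x.1.2, x.2)))

theorem measurable_expTotalAt {g : ℝ → ℝ≥0∞} (hg : Measurable g) (m r : ℕ) :
    Measurable fun x : ℝ × Hist r × ℝ => expTotalAt g s b x.1 m r x.2.1 x.2.2 :=
  measurable_expTotalAt_of_measurable_expTotal s b hg (measurable_expTotal s b hg m (r + 1))

theorem expTotalAt_one_le (v : ℝ) {m r : ℕ} {h : Hist r} {p : ℝ}
    (ih : ∀ a, expTotal (fun _ => 1) s b v m (r + 1) (h.extend p a) ≤ m) :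
    expTotalAt (fun _ => 1) s b v m r h p ≤ (m + 1 : ℕ) :=
  calc expTotalAt (fun _ => 1) s b v m r h p
      ≤ b.respond r v h p true * (1 + m) + b.respond r v h p false * (1 + m) := by
        unfold expTotalAt
        gcongr
        · exact ih true
        · exact (ih false).trans le_add_self
    _ = (m + 1 : ℕ) := by
        rw [← add_mul, b.respond_true_add_respond_false, one_mul, add_comm, Nat.cast_succ]

theorem expTotal_one_le (v : ℝ) (m r : ℕ) (h : Hist r) :
    expTotal (fun _ => 1) s b v m r h ≤ m := by
  induction m generalizing r with
  | zero => simp [expTotal]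
  | succ m ih =>
    have := s.isMarkov r
    calc expTotal (fun _ => 1) s b v (m + 1) r h
        ≤ ∫⁻ _, (m + 1 : ℕ) ∂(s.price r h) :=
          lintegral_mono fun p => expTotalAt_one_le s b v fun a => ih _ _
      _ = (m + 1 : ℕ) := by rw [lintegral_const, measure_univ, mul_one]

theorem sellerUtility_succ (ν : Measure ℝ) [SFinite ν] (m r : ℕ) (h : Hist r) :
    sellerUtility s b ν (m + 1) r h = ∫⁻ p, sellerUtilityAt s b ν m r h p ∂(s.price r h) := by
  have := s.isMarkov r
  refine lintegral_lintegral_swap (f := fun v p => expTotalAt ENNReal.ofReal s b v m r h p) ?_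
  exact ((measurable_expTotalAt s b ENNReal.measurable_ofReal m r).comp
    (by fun_prop : Measurable fun x : ℝ × ℝ => (x.1, h, x.2))).aemeasurable

end ExpectedTotals

section Seller

theorem lintegral_mul_eq_mul_lintegral_of_bayes {Ω : Type*} [MeasurableSpace Ω] {ν ν' : Measure Ω}
    {f g : Ω → ℝ≥0∞} (hf : Measurable f) (hg : Measurable g)
    (hbayes : ∀ B, MeasurableSet B → ν' B * ∫⁻ x, f x ∂ν = ∫⁻ x in B, f x ∂ν) :
    ∫⁻ x, f x * g x ∂ν = (∫⁻ x, f x ∂ν) * ∫⁻ x, g x ∂ν' := by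
  have hdensity : ν.withDensity f = (∫⁻ x, f x ∂ν) • ν' := by
    ext B hB
    rw [withDensity_apply _ hB, ← hbayes B hB, Measure.smul_apply, smul_eq_mul, mul_comm]
  calc ∫⁻ x, f x * g x ∂ν = ∫⁻ x, g x ∂ν.withDensity f :=
        (lintegral_withDensity_eq_lintegral_mul ν hf hg).symm
    _ = (∫⁻ x, f x ∂ν) * ∫⁻ x, g x ∂ν' := by rw [hdensity, lintegral_smul_measure, smul_eq_mul]

/-- A belief system is consistent with the prior `F` and the buyer's strategy `b` if it satisfies
the conditions on beliefs in a perfect Bayesian equilibrium. -/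
structure IsConsistent (n : ℕ) (F : Measure ℝ) (b : BuyerStrategy)
    (μ : ∀ r : ℕ, Hist r → Measure ℝ) : Prop where
  belief_prob : ∀ r ≤ n, ∀ h : Hist r, h.Feasible → IsProbabilityMeasure (μ r h)
  belief_support : ∀ r ≤ n, ∀ h : Hist r, h.Feasible → ∀ᵐ v ∂(μ r h), v ∈ valueSpace
  prior : ∀ h : Hist 0, μ 0 h = F
  bayes : ∀ r < n, ∀ h : Hist r, h.Feasible → ∀ p ∈ h.allowed, ∀ a : Bool,
    ∀ B : Set ℝ, MeasurableSet B →
      μ (r + 1) (h.extend p a) B * ∫⁻ v, b.respond r v h p a ∂(μ r h)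
        = ∫⁻ v in B, b.respond r v h p a ∂(μ r h)

/-- The seller's expected revenue from posting `p` under the belief `ν`, if the rounds after the
current one are worth `W a` to him after the response `a`. -/
def stageRevenue (b : BuyerStrategy) (ν : Measure ℝ) (r : ℕ) (h : Hist r) (p : ℝ)
    (W : Bool → ℝ≥0∞) : ℝ≥0∞ :=
  (∫⁻ v, b.respond r v h p true ∂ν) * (ENNReal.ofReal p + W true)
    + (∫⁻ v, b.respond r v h p false ∂ν) * W false

/-- The Bellman equation of the seller: `V r h` is the most he can expect after `h`, and his
strategy `s` attains it. -/
structure IsSellerValue (n : ℕ) (s : SellerStrategy) (b : BuyerStrategy)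
    (μ : ∀ r : ℕ, Hist r → Measure ℝ) (V : ∀ r : ℕ, Hist r → ℝ≥0∞) : Prop where
  final : ∀ h : Hist n, V n h = 0
  stageRevenue_le : ∀ r < n, ∀ h : Hist r, h.Feasible → ∀ p ∈ h.allowed,
    stageRevenue b (μ r h) r h p (fun a => V (r + 1) (h.extend p a)) ≤ V r h
  lintegral_stageRevenue : ∀ r < n, ∀ h : Hist r, h.Feasible →
    ∫⁻ p, stageRevenue b (μ r h) r h p (fun a => V (r + 1) (h.extend p a)) ∂(s.price r h) = V r h

variable {n : ℕ} {F : Measure ℝ} {s : SellerStrategy} {b : BuyerStrategy}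
  {μ : ∀ r : ℕ, Hist r → Measure ℝ} {V : ∀ r : ℕ, Hist r → ℝ≥0∞}

theorem stageRevenue_mono {ν : Measure ℝ} {r : ℕ} {h : Hist r} {p : ℝ} {W W' : Bool → ℝ≥0∞}
    (hW : ∀ a, W a ≤ W' a) : stageRevenue b ν r h p W ≤ stageRevenue b ν r h p W' := by
  have := hW true
  have := hW false
  unfold stageRevenue
  gcongr

theorem IsConsistent.sellerUtilityAt_eq (hμ : IsConsistent n F b μ) {m r : ℕ} (hr : r < n)
    {h : Hist r} (hf : h.Feasible) {p : ℝ} (hp : p ∈ h.allowed) (s : SellerStrategy) :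
    sellerUtilityAt s b (μ r h) m r h p = stageRevenue b (μ r h) r h p fun a =>
      sellerUtility s b (μ (r + 1) (h.extend p a)) m (r + 1) (h.extend p a) := by
  have := hμ.belief_prob (r + 1) hr _ (hf.extend hp true)
  have htotal (a : Bool) : Measurable fun v =>
      expTotal ENNReal.ofReal s b v m (r + 1) (h.extend p a) :=
    (measurable_expTotal s b ENNReal.measurable_ofReal m (r + 1)).comp
      (by fun_prop : Measurable fun v : ℝ => (v, h.extend p a))
  have hrespond (a : Bool) : Measurable fun v => b.respond r v h p a :=
    (b.measurable_respond r a).comp (by fun_prop : Measurable fun v : ℝ => (v, h, p))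
  have hbayes (a : Bool) {G : ℝ → ℝ≥0∞} (hG : Measurable G) :=
    lintegral_mul_eq_mul_lintegral_of_bayes (hrespond a) hG (hμ.bayes r hr h hf p hp a)
  have hfalse : Measurable fun v => b.respond r v h p false *
      expTotal ENNReal.ofReal s b v m (r + 1) (h.extend p false) :=
    (hrespond false).mul (htotal false)
  have htrue : Measurable fun v => ENNReal.ofReal p +
      expTotal ENNReal.ofReal s b v m (r + 1) (h.extend p true) :=
    (htotal true).const_add _
  unfold sellerUtilityAt expTotalAt stageRevenue sellerUtility
  rw [lintegral_add_right _ hfalse, hbayes true htrue, hbayes false (htotal false),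
    lintegral_add_left measurable_const, lintegral_const, measure_univ, mul_one]

theorem IsSellerValue.sellerUtility_le (hV : IsSellerValue n s b μ V)
    (hμ : IsConsistent n F b μ) (s' : SellerStrategy) {m r : ℕ} (hr : r + m = n) {h : Hist r}
    (hf : h.Feasible) : sellerUtility s' b (μ r h) m r h ≤ V r h := by
  induction m generalizing r with
  | zero => simp [sellerUtility, expTotal]
  | succ m ih =>
    have hrn : r < n := by omega
    have := hμ.belief_prob r hrn.le h hf
    have := s'.isMarkov r
    calc sellerUtility s' b (μ r h) (m + 1) r h
        = ∫⁻ p, sellerUtilityAt s' b (μ r h) m r h p ∂(s'.price r h) := sellerUtility_succ ..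
      _ ≤ ∫⁻ _, V r h ∂(s'.price r h) := by
        refine lintegral_mono_ae ?_
        filter_upwards [s'.allowed r h hf] with p hp
        rw [hμ.sellerUtilityAt_eq hrn hf hp]
        exact (stageRevenue_mono fun a => ih (by omega) (hf.extend hp a)).trans
          (hV.stageRevenue_le r hrn h hf p hp)
      _ = V r h := by rw [lintegral_const, measure_univ, mul_one]

theorem IsSellerValue.sellerUtility_eq (hV : IsSellerValue n s b μ V)
    (hμ : IsConsistent n F b μ) {m r : ℕ} (hr : r + m = n) {h : Hist r} (hf : h.Feasible) :
    sellerUtility s b (μ r h) m r h = V r h := by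
  induction m generalizing r with
  | zero =>
    obtain rfl : r = n := hr
    simp [sellerUtility, expTotal, hV.final]
  | succ m ih =>
    have hrn : r < n := by omega
    have := hμ.belief_prob r hrn.le h hf
    rw [sellerUtility_succ, ← hV.lintegral_stageRevenue r hrn h hf]
    refine lintegral_congr_ae ?_
    filter_upwards [s.allowed r h hf] with p hp
    simp only [hμ.sellerUtilityAt_eq hrn hf hp, ih (by omega) (hf.extend hp _)]

theorem IsSellerValue.sellerUtilityAt_le (hV : IsSellerValue n s b μ V)
    (hμ : IsConsistent n F b μ) (s' : SellerStrategy) {m r : ℕ} (hr : r + (m + 1) = n)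
    {h : Hist r} (hf : h.Feasible) {p : ℝ} (hp : p ∈ h.allowed) :
    sellerUtilityAt s' b (μ r h) m r h p ≤ sellerUtilityAt s b (μ r h) m r h p := by
  have hrn : r < n := by omega
  rw [hμ.sellerUtilityAt_eq hrn hf hp, hμ.sellerUtilityAt_eq hrn hf hp]
  refine stageRevenue_mono fun a => ?_
  rw [hV.sellerUtility_eq hμ (by omega) (hf.extend hp a)]
  exact hV.sellerUtility_le hμ s' (by omega) (hf.extend hp a)

end Seller

section Buyer

/-- The utility of a buyer of value `v` from his better response to the price `p`, if the rounds
after the current one are worth `W a` to him after the response `a`. The truncated subtraction is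
harmless, because rejecting yields at least `0`. -/
def stageUtility (v p : ℝ) (W : Bool → ℝ≥0∞) : ℝ≥0∞ :=
  max (ENNReal.ofReal v + W true - ENNReal.ofReal p) (W false)

/-- The Bellman equation of a buyer of value `v`: `U r h` is the most he can expect after `h`,
and his strategy `b` only uses responses which attain it. -/
structure IsBuyerValue (n : ℕ) (s : SellerStrategy) (b : BuyerStrategy) (v : ℝ)
    (U : ∀ r : ℕ, Hist r → ℝ≥0∞) : Prop where
  final : ∀ h : Hist n, U n h = 0
  of_accept : ∀ r < n, ∀ h : Hist r, h.Feasible → ∀ p ∈ h.allowed, b.accept r v h p ≠ 0 →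
    U (r + 1) (h.extend p false) + ENNReal.ofReal p
      ≤ ENNReal.ofReal v + U (r + 1) (h.extend p true)
  of_reject : ∀ r < n, ∀ h : Hist r, h.Feasible → ∀ p ∈ h.allowed, b.accept r v h p ≠ 1 →
    ENNReal.ofReal v + U (r + 1) (h.extend p true)
      ≤ U (r + 1) (h.extend p false) + ENNReal.ofReal p
  lintegral_stageUtility : ∀ r < n, ∀ h : Hist r, h.Feasible →
    ∫⁻ p, stageUtility v p (fun a => U (r + 1) (h.extend p a)) ∂(s.price r h) = U r h

variable {n : ℕ} {s : SellerStrategy} {b : BuyerStrategy} {v : ℝ} {U : ∀ r : ℕ, Hist r → ℝ≥0∞}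

theorem mul_expTotalAt_le {m r : ℕ} {h : Hist r} {p : ℝ} {W : Bool → ℝ≥0∞}
    (hW : ∀ a, ENNReal.ofReal v * expTotal (fun _ => 1) s b v m (r + 1) (h.extend p a)
      ≤ W a + expTotal ENNReal.ofReal s b v m (r + 1) (h.extend p a)) :
    ENNReal.ofReal v * expTotalAt (fun _ => 1) s b v m r h p
      ≤ stageUtility v p W + expTotalAt ENNReal.ofReal s b v m r h p := by
  have haccept : ENNReal.ofReal v + W true ≤ stageUtility v p W + ENNReal.ofReal p :=
    le_tsub_add.trans (by gcongr; exact le_max_left _ _)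
  have hreject : W false ≤ stageUtility v p W := le_max_right _ _
  have hsum := b.respond_true_add_respond_false r v h p
  unfold expTotalAt
  set α := b.respond r v h p true
  set β := b.respond r v h p false
  set N := fun a => expTotal (fun _ => 1) s b v m (r + 1) (h.extend p a)
  set C := fun a => expTotal ENNReal.ofReal s b v m (r + 1) (h.extend p a)
  calc ENNReal.ofReal v * (α * (1 + N true) + β * N false)
      = α * (ENNReal.ofReal v + ENNReal.ofReal v * N true)
          + β * (ENNReal.ofReal v * N false) := by ring
    _ ≤ α * (ENNReal.ofReal v + (W true + C true)) + β * (W false + C false) := by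
        gcongr
        · exact hW true
        · exact hW false
    _ = α * (ENNReal.ofReal v + W true + C true) + β * (W false + C false) := by ring
    _ ≤ α * (stageUtility v p W + ENNReal.ofReal p + C true)
          + β * (stageUtility v p W + C false) := by gcongr
    _ = (α + β) * stageUtility v p W
          + (α * (ENNReal.ofReal p + C true) + β * C false) := by ring
    _ = stageUtility v p W + (α * (ENNReal.ofReal p + C true) + β * C false) := by
        rw [hsum, one_mul]

theorem mul_expTotalAt_eq {m r : ℕ} {h : Hist r} {p : ℝ} {W : Bool → ℝ≥0∞}
    (haccept : b.accept r v h p ≠ 0 →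
      W false + ENNReal.ofReal p ≤ ENNReal.ofReal v + W true)
    (hreject : b.accept r v h p ≠ 1 →
      ENNReal.ofReal v + W true ≤ W false + ENNReal.ofReal p)
    (hW : ∀ a, ENNReal.ofReal v * expTotal (fun _ => 1) s b v m (r + 1) (h.extend p a)
      = W a + expTotal ENNReal.ofReal s b v m (r + 1) (h.extend p a)) :
    ENNReal.ofReal v * expTotalAt (fun _ => 1) s b v m r h p
      = stageUtility v p W + expTotalAt ENNReal.ofReal s b v m r h p := by
  have htrue : b.respond r v h p true * (ENNReal.ofReal v + W true)
      = b.respond r v h p true * (stageUtility v p W + ENNReal.ofReal p) := by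
    rcases eq_or_ne (b.accept r v h p) 0 with h0 | h0
    · simp [BuyerStrategy.respond, h0]
    · have hle := haccept h0
      rw [stageUtility, max_eq_left (ENNReal.le_sub_of_add_le_right ENNReal.ofReal_ne_top hle),
        tsub_add_cancel_of_le (le_add_self.trans hle)]
  have hfalse : b.respond r v h p false * W false
      = b.respond r v h p false * stageUtility v p W := by
    rcases eq_or_ne (b.accept r v h p) 1 with h1 | h1
    · simp [BuyerStrategy.respond, h1]
    · rw [stageUtility, max_eq_right (tsub_le_iff_right.2 (hreject h1))]
  have hsum := b.respond_true_add_respond_false r v h p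
  unfold expTotalAt
  set α := b.respond r v h p true
  set β := b.respond r v h p false
  set N := fun a => expTotal (fun _ => 1) s b v m (r + 1) (h.extend p a)
  set C := fun a => expTotal ENNReal.ofReal s b v m (r + 1) (h.extend p a)
  calc ENNReal.ofReal v * (α * (1 + N true) + β * N false)
      = α * (ENNReal.ofReal v + ENNReal.ofReal v * N true)
          + β * (ENNReal.ofReal v * N false) := by ring
    _ = α * (ENNReal.ofReal v + (W true + C true)) + β * (W false + C false) := by
        rw [hW true, hW false]
    _ = α * (ENNReal.ofReal v + W true) + α * C true + (β * W false + β * C false) := by ring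
    _ = (α + β) * stageUtility v p W
          + (α * (ENNReal.ofReal p + C true) + β * C false) := by rw [htrue, hfalse]; ring
    _ = stageUtility v p W + (α * (ENNReal.ofReal p + C true) + β * C false) := by
        rw [hsum, one_mul]

theorem lintegral_mul_expTotalAt (m r : ℕ) (h : Hist r) :
    ∫⁻ p, ENNReal.ofReal v * expTotalAt (fun _ => 1) s b v m r h p ∂(s.price r h)
      = ENNReal.ofReal v * expTotal (fun _ => 1) s b v (m + 1) r h :=
  lintegral_const_mul _ ((measurable_expTotalAt s b measurable_const m r).comp
    (by fun_prop : Measurable fun p : ℝ => (v, h, p)))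

theorem IsBuyerValue.lintegral_stageUtility_add (hU : IsBuyerValue n s b v U) {r : ℕ}
    (hr : r < n) {h : Hist r} (hf : h.Feasible) (b' : BuyerStrategy) (m : ℕ) :
    ∫⁻ p, stageUtility v p (fun a => U (r + 1) (h.extend p a))
        + expTotalAt ENNReal.ofReal s b' v m r h p ∂(s.price r h)
      = U r h + expTotal ENNReal.ofReal s b' v (m + 1) r h := by
  rw [expTotal_succ, ← hU.lintegral_stageUtility r hr h hf]
  exact lintegral_add_right _ ((measurable_expTotalAt s b' ENNReal.measurable_ofReal m r).comp
    (by fun_prop : Measurable fun p : ℝ => (v, h, p)))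

theorem IsBuyerValue.mul_expTotal_le (hU : IsBuyerValue n s b v U) (b' : BuyerStrategy) {m r : ℕ}
    (hr : r + m = n) {h : Hist r} (hf : h.Feasible) :
    ENNReal.ofReal v * expTotal (fun _ => 1) s b' v m r h
      ≤ U r h + expTotal ENNReal.ofReal s b' v m r h := by
  induction m generalizing r with
  | zero => simp [expTotal]
  | succ m ih =>
    rw [← lintegral_mul_expTotalAt, ← hU.lintegral_stageUtility_add (by omega) hf]
    refine lintegral_mono_ae ?_
    filter_upwards [s.allowed r h hf] with p hp
    exact mul_expTotalAt_le fun a => ih (by omega) (hf.extend hp a)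

theorem IsBuyerValue.mul_expTotal_eq (hU : IsBuyerValue n s b v U) {m r : ℕ} (hr : r + m = n)
    {h : Hist r} (hf : h.Feasible) :
    ENNReal.ofReal v * expTotal (fun _ => 1) s b v m r h
      = U r h + expTotal ENNReal.ofReal s b v m r h := by
  induction m generalizing r with
  | zero =>
    obtain rfl : r = n := hr
    simp [expTotal, hU.final]
  | succ m ih =>
    have hrn : r < n := by omega
    rw [← lintegral_mul_expTotalAt, ← hU.lintegral_stageUtility_add hrn hf]
    refine lintegral_congr_ae ?_
    filter_upwards [s.allowed r h hf] with p hp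
    exact mul_expTotalAt_eq (hU.of_accept r hrn h hf p hp) (hU.of_reject r hrn h hf p hp)
      fun a => ih (by omega) (hf.extend hp a)

theorem coe_sub_coe_le_of_eq_add {A B A' B' W : ℝ≥0∞} (h : A ≤ W + B) (h' : A' = W + B')
    (hA' : A' ≠ ⊤) : (A : EReal) - B ≤ (A' : EReal) - B' := by
  have hB' : B' ≠ ⊤ := fun hB => hA' (by rw [h', hB, add_top])
  calc (A : EReal) - B ≤ W := EReal.sub_le_of_le_add (by exact_mod_cast h)
    _ = (A' : EReal) - B' := by
        lift B' to NNReal using hB'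
        rw [h', EReal.coe_ennreal_add, EReal.coe_nnreal_eq_coe_real, EReal.add_sub_cancel_right]

theorem IsBuyerValue.buyerUtility_le (hU : IsBuyerValue n s b v U) (b' : BuyerStrategy) {m r : ℕ}
    (hr : r + m = n) {h : Hist r} (hf : h.Feasible) :
    buyerUtility s b' v m r h ≤ buyerUtility s b v m r h :=
  coe_sub_coe_le_of_eq_add (hU.mul_expTotal_le b' hr hf) (hU.mul_expTotal_eq hr hf)
    (ENNReal.mul_ne_top ENNReal.ofReal_ne_top
      (ne_top_of_le_ne_top (ENNReal.natCast_ne_top m) (expTotal_one_le s b v m r h)))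

theorem IsBuyerValue.buyerUtilityAt_le (hU : IsBuyerValue n s b v U) (b' : BuyerStrategy)
    {m r : ℕ} (hr : r + (m + 1) = n) {h : Hist r} (hf : h.Feasible) {p : ℝ}
    (hp : p ∈ h.allowed) :
    buyerUtilityAt s b' v m r h p ≤ buyerUtilityAt s b v m r h p := by
  have hrn : r < n := by omega
  refine coe_sub_coe_le_of_eq_add
    (mul_expTotalAt_le fun a => hU.mul_expTotal_le b' (by omega) (hf.extend hp a))
    (mul_expTotalAt_eq (hU.of_accept r hrn h hf p hp) (hU.of_reject r hrn h hf p hp)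
      fun a => hU.mul_expTotal_eq (by omega) (hf.extend hp a))
    (ENNReal.mul_ne_top ENNReal.ofReal_ne_top ?_)
  exact ne_top_of_le_ne_top (ENNReal.natCast_ne_top (m + 1))
    (expTotalAt_one_le s b v fun a => expTotal_one_le ..)

end Buyer

theorem isPBE_of_isSellerValue_of_isBuyerValue {n : ℕ} {F : Measure ℝ} {s : SellerStrategy}
    {b : BuyerStrategy} {μ : ∀ r : ℕ, Hist r → Measure ℝ} {V : ∀ r : ℕ, Hist r → ℝ≥0∞}
    {U : ℝ → ∀ r : ℕ, Hist r → ℝ≥0∞} (hμ : IsConsistent n F b μ)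
    (hV : IsSellerValue n s b μ V) (hU : ∀ v ∈ valueSpace, IsBuyerValue n s b v (U v)) :
    IsPBE n F s b μ where
  belief_prob := hμ.belief_prob
  belief_support := hμ.belief_support
  prior := hμ.prior
  bayes := hμ.bayes
  seller_opt _ _ hr _ hf s' :=
    (hV.sellerUtility_le hμ s' hr hf).trans_eq (hV.sellerUtility_eq hμ hr hf).symm
  seller_opt_at _ _ hr _ hf _ hp s' := hV.sellerUtilityAt_le hμ s' hr hf hp
  buyer_opt _ _ hr _ hf v hv b' := (hU v hv).buyerUtility_le b' hr hf
  buyer_opt_at _ _ hr _ hf _ hp v hv b' := (hU v hv).buyerUtilityAt_le b' hr hf hp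

section ThresholdStrategy

/-- The values of the buyers who give the response `a` when their threshold is `t`. -/
def responseSet (t : ℝ) : Bool → Set ℝ
  | true => Set.Ici t
  | false => Set.Iio t

theorem measurableSet_responseSet (t : ℝ) (a : Bool) : MeasurableSet (responseSet t a) := by
  cases a
  · exact measurableSet_Iio
  · exact measurableSet_Ici

/-- The strategy of a buyer who accepts `p` after `h` if and only if his value is at least
`t r h p`. -/
def thresholdStrategy (t : ∀ r : ℕ, Hist r → ℝ → ℝ)
    (ht : ∀ r, Measurable fun x : Hist r × ℝ => t r x.1 x.2) : BuyerStrategy where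
  accept r v h p := if t r h p ≤ v then 1 else 0
  accept_le_one r v h p := by split_ifs <;> simp
  measurable_accept r := Measurable.ite
    (measurableSet_le ((ht r).comp measurable_snd) measurable_fst) measurable_const
    measurable_const

variable {t : ∀ r : ℕ, Hist r → ℝ → ℝ} {ht : ∀ r, Measurable fun x : Hist r × ℝ => t r x.1 x.2}

theorem isThreshold_thresholdStrategy {n : ℕ}
    (hnonneg : ∀ r < n, ∀ h : Hist r, h.Feasible → ∀ p ∈ h.allowed, 0 ≤ t r h p) :
    (thresholdStrategy t ht).IsThreshold n :=
  ⟨t, fun r hr h hf p hp => ⟨hnonneg r hr h hf p hp, fun v _ => by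
    simp only [thresholdStrategy]⟩⟩

theorem respond_thresholdStrategy (r : ℕ) (v : ℝ) (h : Hist r) (p : ℝ) (a : Bool) :
    (thresholdStrategy t ht).respond r v h p a = (responseSet (t r h p) a).indicator 1 v := by
  cases a <;> by_cases hv : t r h p ≤ v <;>
    simp [BuyerStrategy.respond, thresholdStrategy, responseSet, Set.indicator, hv]

theorem lintegral_respond_thresholdStrategy (ν : Measure ℝ) (r : ℕ) (h : Hist r) (p : ℝ)
    (a : Bool) :
    ∫⁻ v, (thresholdStrategy t ht).respond r v h p a ∂ν = ν (responseSet (t r h p) a) := by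
  simp only [respond_thresholdStrategy]
  exact lintegral_indicator_one (measurableSet_responseSet _ _)

theorem stageRevenue_thresholdStrategy (ν : Measure ℝ) [IsProbabilityMeasure ν] (r : ℕ)
    (h : Hist r) {p : ℝ} (hp : 0 ≤ p) {W : Bool → ℝ} (hW : ∀ a, 0 ≤ W a) :
    stageRevenue (thresholdStrategy t ht) ν r h p (fun a => ENNReal.ofReal (W a))
      = ENNReal.ofReal ((1 - ν.real (Set.Iio (t r h p))) * (p + W true)
          + ν.real (Set.Iio (t r h p)) * W false) := by
  have hq : ν.real (Set.Iio (t r h p)) ≤ 1 := measureReal_le_one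
  have htrue : ν (responseSet (t r h p) true)
      = ENNReal.ofReal (1 - ν.real (Set.Iio (t r h p))) := by
    rw [← probReal_compl_eq_one_sub measurableSet_Iio, Set.compl_Iio, ofReal_measureReal]
    rfl
  have hfalse : ν (responseSet (t r h p) false) = ENNReal.ofReal (ν.real (Set.Iio (t r h p))) := by
    rw [ofReal_measureReal]
    rfl
  rw [stageRevenue, lintegral_respond_thresholdStrategy, lintegral_respond_thresholdStrategy,
    htrue, hfalse, ← ENNReal.ofReal_add hp (hW true), ← ENNReal.ofReal_mul (sub_nonneg.2 hq),
    ← ENNReal.ofReal_mul measureReal_nonneg,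
    ← ENNReal.ofReal_add (mul_nonneg (sub_nonneg.2 hq) (add_nonneg hp (hW true)))
      (mul_nonneg measureReal_nonneg (hW false))]

/-- The belief `ν` about the buyer's value, updated after the response `a` given according to the
threshold `t`. After a response of probability zero we choose a belief which supports the
equilibrium: an unexpected rejection is ignored, an unexpected acceptance is attributed to the
highest value. -/
def update (ν : Measure ℝ) (t : ℝ) (a : Bool) : Measure ℝ :=
  if ν (responseSet t a) = 0 then if a then Measure.dirac 1 else ν else ν[|responseSet t a]

theorem isProbabilityMeasure_update (ν : Measure ℝ) [IsProbabilityMeasure ν] (t : ℝ) (a : Bool) :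
    IsProbabilityMeasure (update ν t a) := by
  unfold update
  split_ifs with h0
  · infer_instance
  · infer_instance
  · exact cond_isProbabilityMeasure h0

theorem ae_update_of_ae {ν : Measure ℝ} {P : ℝ → Prop} (hP : ∀ᵐ v ∂ν, P v) (h1 : P 1) (t : ℝ)
    (a : Bool) : ∀ᵐ v ∂(update ν t a), P v := by
  unfold update
  split_ifs
  · rwa [ae_dirac_eq]
  · exact hP
  · exact cond_absolutelyContinuous.ae_le hP

theorem update_mul_measure_responseSet (ν : Measure ℝ) [IsFiniteMeasure ν] (t : ℝ) (a : Bool)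
    (B : Set ℝ) : update ν t a B * ν (responseSet t a) = ν (responseSet t a ∩ B) := by
  by_cases h0 : ν (responseSet t a) = 0
  · rw [h0, mul_zero, measure_mono_null Set.inter_subset_left h0]
  · rw [update, if_neg h0, cond_mul_eq_inter (measurableSet_responseSet t a)]

/-- The seller's beliefs when the prior is `F` and the buyer's thresholds are `t`. -/
def posterior (F : Measure ℝ) (t : ∀ r : ℕ, Hist r → ℝ → ℝ) : ∀ r : ℕ, Hist r → Measure ℝ
  | 0, _ => F
  | r + 1, h => update (posterior F t r (Fin.init h))
      (t r (Fin.init h) (h (Fin.last r)).1) (h (Fin.last r)).2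

variable {F : Measure ℝ}

theorem posterior_extend (r : ℕ) (h : Hist r) (p : ℝ) (a : Bool) :
    posterior F t (r + 1) (h.extend p a) = update (posterior F t r h) (t r h p) a := by
  simp [posterior, Hist.extend]

theorem isProbabilityMeasure_posterior [IsProbabilityMeasure F] (r : ℕ) (h : Hist r) :
    IsProbabilityMeasure (posterior F t r h) := by
  induction r with
  | zero => assumption
  | succ r ih =>
    have := ih (Fin.init h)
    exact isProbabilityMeasure_update ..

theorem ae_posterior_of_ae {P : ℝ → Prop} (hP : ∀ᵐ v ∂F, P v) (h1 : P 1) (r : ℕ) (h : Hist r) :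
    ∀ᵐ v ∂(posterior F t r h), P v := by
  induction r with
  | zero => exact hP
  | succ r ih => exact ae_update_of_ae (ih (Fin.init h)) h1 _ _

theorem isConsistent_posterior [IsProbabilityMeasure F] (hF : ∀ᵐ v ∂F, v ∈ valueSpace) (n : ℕ) :
    IsConsistent n F (thresholdStrategy t ht) (posterior F t) where
  belief_prob r _ h _ := isProbabilityMeasure_posterior r h
  belief_support r _ h _ := ae_posterior_of_ae hF ⟨zero_le_one, le_rfl⟩ r h
  prior _ := rfl
  bayes r _ h _ p _ a B hB := by
    have := isProbabilityMeasure_posterior (F := F) (t := t) r h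
    rw [lintegral_respond_thresholdStrategy, lintegral_respond_thresholdStrategy,
      posterior_extend, Measure.restrict_apply' hB]
    exact update_mul_measure_responseSet ..

end ThresholdStrategy

section Rates

/-- The seller's expected revenue from posting the price with threshold `s`, if the buyer's value
has distribution function `x ^ α` on `[0, 1]`, the buyers with value at least `s` pay `(1 + w) * s`
in total, and the revenue after a rejection is `R * s`. -/
def scaledRevenue (α w R s : ℝ) : ℝ :=
  (1 + w) * s * (1 - s ^ α) + R * s * s ^ α

/-- A threshold which maximizes `scaledRevenue`. -/
def bestFraction (α w R : ℝ) : unitInterval :=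
  Classical.epsilon fun s => ∀ x : unitInterval, scaledRevenue α w R x ≤ scaledRevenue α w R s

theorem scaledRevenue_le_bestFraction {α : ℝ} (hα : 0 ≤ α) (w R : ℝ) {x : ℝ}
    (hx : x ∈ unitInterval) : scaledRevenue α w R x ≤ scaledRevenue α w R (bestFraction α w R) := by
  have hcont : Continuous fun s : unitInterval => scaledRevenue α w R s := by
    have := (Real.continuous_rpow_const hα).comp
      (continuous_subtype_val : Continuous ((↑) : unitInterval → ℝ))
    unfold scaledRevenue
    fun_prop
  obtain ⟨s, -, hs⟩ := isCompact_univ.exists_isMaxOn Set.univ_nonempty hcont.continuousOn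
  exact Classical.epsilon_spec (p := fun s : unitInterval =>
    ∀ x : unitInterval, scaledRevenue α w R x ≤ scaledRevenue α w R s)
    ⟨s, fun x => hs (Set.mem_univ x)⟩ ⟨x, hx⟩

/-- Given that nothing has been sold and that the buyer's value has distribution function
`(x / a) ^ α` on `[0, a]`, let `m` rounds remain. In equilibrium, the buyers of the highest values
pay `(rates α m).1 * a` in total, and the seller's expected revenue is `(rates α m).2 * a`. -/
def rates (α : ℝ) : ℕ → ℝ × ℝ
  | 0 => (0, 0)
  | j + 1 =>
    let (w, R) := rates α j
    ((1 + w) * bestFraction α w R, scaledRevenue α w R (bestFraction α w R))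

/-- The total payment of the buyers of the highest values, see `rates`. -/
def paymentRate (α : ℝ) (m : ℕ) : ℝ := (rates α m).1

/-- The seller's expected revenue, see `rates`. -/
def revenueRate (α : ℝ) (m : ℕ) : ℝ := (rates α m).2

/-- The threshold in the current round when `j` rounds follow it, as a fraction of the highest
possible value of the buyer. -/
def thresholdRate (α : ℝ) (j : ℕ) : ℝ := bestFraction α (paymentRate α j) (revenueRate α j)

variable {α : ℝ}

theorem paymentRate_succ (j : ℕ) :
    paymentRate α (j + 1) = (1 + paymentRate α j) * thresholdRate α j :=
  rfl

theorem thresholdRate_nonneg (j : ℕ) : 0 ≤ thresholdRate α j := unitInterval.nonneg _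

theorem thresholdRate_le_one (j : ℕ) : thresholdRate α j ≤ 1 := unitInterval.le_one _

theorem scaledRevenue_le_revenueRate_succ (hα : 0 ≤ α) (j : ℕ) {x : ℝ} (hx : x ∈ unitInterval) :
    scaledRevenue α (paymentRate α j) (revenueRate α j) x ≤ revenueRate α (j + 1) :=
  scaledRevenue_le_bestFraction hα _ _ hx

theorem revenueRate_nonneg (hα : 0 ≤ α) (m : ℕ) : 0 ≤ revenueRate α m := by
  cases m with
  | zero => exact le_rfl
  | succ j =>
    simpa [scaledRevenue] using scaledRevenue_le_revenueRate_succ hα j unitInterval.zero_mem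

theorem paymentRate_nonneg (m : ℕ) : 0 ≤ paymentRate α m := by
  induction m with
  | zero => exact le_rfl
  | succ j ih => exact mul_nonneg (add_nonneg zero_le_one ih) (thresholdRate_nonneg j)

theorem paymentRate_le (m : ℕ) : paymentRate α m ≤ m := by
  induction m with
  | zero => simp [paymentRate, rates]
  | succ j ih =>
    have hw : 0 ≤ 1 + paymentRate α j := by linarith [paymentRate_nonneg (α := α) j]
    calc paymentRate α (j + 1) ≤ 1 + paymentRate α j :=
          mul_le_of_le_one_right hw (thresholdRate_le_one j)
      _ ≤ (j + 1 : ℕ) := by push_cast; linarith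

end Rates

section Threshold

/-- The solution `θ` of `θ + w * min a θ = y`: a buyer of value `θ` is indifferent between getting
the item in the current and all later rounds for `y` in total, and getting it only in the later
rounds for `w * min a θ` in total. -/
def threshold (w a y : ℝ) : ℝ := max (y / (1 + w)) (y - w * a)

variable {w a y : ℝ}

theorem threshold_add_mul_min (hw : 0 ≤ w) : threshold w a y + w * min a (threshold w a y) = y := by
  have hw1 : 0 < 1 + w := by linarith
  have hy : (1 + w) * (y / (1 + w)) = y := mul_div_cancel₀ y hw1.ne'
  unfold threshold
  rcases le_total (y / (1 + w)) a with h | h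
  · have := mul_le_mul_of_nonneg_left h hw
    rw [max_eq_left (by linarith), min_eq_right h]
    linarith
  · have := mul_le_mul_of_nonneg_left h hw
    rw [max_eq_right (by linarith), min_eq_left (by linarith)]
    linarith

theorem threshold_nonneg (hw : 0 ≤ w) (hy : 0 ≤ y) : 0 ≤ threshold w a y :=
  le_max_of_le_left (by positivity)

theorem le_one_add_mul_threshold (hw : 0 ≤ w) : y ≤ (1 + w) * threshold w a y := by
  have := mul_le_mul_of_nonneg_left (min_le_right a (threshold w a y)) hw
  linarith [threshold_add_mul_min (a := a) (y := y) hw]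

theorem threshold_one_add_mul (hw : 0 ≤ w) {x : ℝ} (hx : x ≤ a) :
    threshold w a ((1 + w) * x) = x := by
  have := mul_le_mul_of_nonneg_left hx hw
  rw [threshold, mul_div_cancel_left₀ x (by linarith), max_eq_left (by linarith)]

/-- The least upper bound of the buyer's value after he has rejected a price of threshold `θ`, if
it was `a` before. If `θ ≤ 0`, the rejection was unexpected and is ignored. -/
def nextTop (a θ : ℝ) : ℝ := if 0 < θ then min a θ else a

theorem nextTop_le (a θ : ℝ) : nextTop a θ ≤ a := by
  unfold nextTop
  split_ifs
  · exact min_le_left a θ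
  · exact le_rfl

theorem nextTop_pos {a : ℝ} (ha : 0 < a) (θ : ℝ) : 0 < nextTop a θ := by
  unfold nextTop
  split_ifs with h
  · exact lt_min ha h
  · exact ha

theorem le_nextTop {a θ : ℝ} (h : θ ≤ a) : θ ≤ nextTop a θ := by
  unfold nextTop
  split_ifs
  · exact le_min h le_rfl
  · exact h

end Threshold

/-- What the equilibrium strategies depend on besides the number of rounds left. As long as nothing
has been sold, this is the least upper bound `top` of the buyer's value according to the seller's
belief; after the first sale it is the least of the accepted prices and `1`. -/
inductive State
  | unsold (top : ℝ)
  | sold (cap : ℝ)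

namespace State

/-- The encoding of states which transports the measurable structure of `Bool × ℝ`. -/
def toProd : State → Bool × ℝ
  | unsold a => (false, a)
  | sold c => (true, c)

instance : MeasurableSpace State := .comap toProd inferInstance

theorem measurable_unsold : Measurable unsold :=
  measurable_comap_iff.2 measurable_prodMk_left

theorem measurable_sold : Measurable sold :=
  measurable_comap_iff.2 measurable_prodMk_left

theorem measurable_of_measurable_unsold_sold {γ δ : Type*} [MeasurableSpace γ]
    [MeasurableSpace δ] {f : State × γ → δ}
    (hunsold : Measurable fun x : ℝ × γ => f (unsold x.1, x.2))
    (hsold : Measurable fun x : ℝ × γ => f (sold x.1, x.2)) : Measurable f := by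
  let g : Bool × ℝ × γ → δ
    | (false, x) => f (unsold x.1, x.2)
    | (true, x) => f (sold x.1, x.2)
  have hg : Measurable g := measurable_from_prod_countable_right fun b => by
    cases b
    · exact hunsold
    · exact hsold
  have htoProd : Measurable toProd := comap_measurable _
  have hfg : f = g ∘ fun x : State × γ => ((toProd x.1).1, (toProd x.1).2, x.2) := by
    funext ⟨x, y⟩
    cases x <;> rfl
  rw [hfg]
  exact hg.comp (by fun_prop)

/-- The price which the seller posts when `m` rounds remain. For `m = 0`, when he posts none, the
division gives `0`. -/
def price (α : ℝ) (m : ℕ) : State → ℝ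
  | unsold a => paymentRate α m / m * a
  | sold c => c

/-- The threshold above which the buyer accepts the price `p` when `j` rounds follow. -/
def thr (α : ℝ) (j : ℕ) (p : ℝ) : State → ℝ
  | unsold a => threshold (paymentRate α j) a ((j + 1) * p)
  | sold _ => p

/-- The state after a round with the given price and response, when `j` rounds follow. -/
def step (α : ℝ) (j : ℕ) : State → ℝ × Bool → State
  | unsold _, (p, true) => sold (min 1 p)
  | unsold a, (p, false) => unsold (nextTop a ((unsold a).thr α j p))
  | sold c, (p, true) => sold (min c p)
  | sold c, (_, false) => sold c

/-- An upper bound for the prices which the seller posts. -/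
def cap : State → ℝ
  | unsold _ => 1
  | sold c => c

/-- The bounds satisfied by the states which histories lead to. -/
def Valid : State → Prop
  | unsold a => 0 < a ∧ a ≤ 1
  | sold c => 0 ≤ c ∧ c ≤ 1

variable {α : ℝ}

theorem measurable_thr (j : ℕ) : Measurable fun x : State × ℝ => x.1.thr α j x.2 := by
  refine measurable_of_measurable_unsold_sold ?_ measurable_snd
  simp only [thr, threshold]
  fun_prop

theorem measurable_price (m : ℕ) : Measurable (price α m) := by
  have : Measurable fun x : State × Unit => x.1.price α m :=
    measurable_of_measurable_unsold_sold (by simp only [price]; fun_prop) measurable_fst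
  exact this.comp (measurable_prodMk_right (y := ()))

theorem measurable_step (j : ℕ) : Measurable fun x : State × ℝ × Bool => x.1.step α j x.2 := by
  have hstep (a : Bool) : Measurable fun x : State × ℝ => x.1.step α j (x.2, a) := by
    cases a
    · have hthr : Measurable fun x : ℝ × ℝ => (unsold x.1).thr α j x.2 :=
        (measurable_thr j).comp (measurable_unsold.prodMap measurable_id)
      exact measurable_of_measurable_unsold_sold
        (measurable_unsold.comp (Measurable.ite (measurableSet_lt measurable_const hthr)
          (measurable_fst.min hthr) measurable_fst))
        (measurable_sold.comp measurable_fst)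
    · exact measurable_of_measurable_unsold_sold
        (measurable_sold.comp (measurable_const.min measurable_snd))
        (measurable_sold.comp (measurable_fst.min measurable_snd))
  have hprod : Measurable fun x : (State × ℝ) × Bool => x.1.1.step α j (x.1.2, x.2) :=
    measurable_from_prod_countable_left hstep
  exact hprod.comp MeasurableEquiv.prodAssoc.symm.measurable

theorem cap_step_le (j : ℕ) (x : State) (p : ℝ × Bool) : (x.step α j p).cap ≤ x.cap := by
  rcases x with a | c <;> rcases p with ⟨p, _ | _⟩
  · exact le_rfl
  · exact min_le_left _ _
  · exact le_rfl
  · exact min_le_left _ _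

theorem cap_step_true_le (j : ℕ) (x : State) (p : ℝ) : (x.step α j (p, true)).cap ≤ p := by
  cases x <;> exact min_le_right _ _

theorem min_one_le_cap_step {j : ℕ} {x : State} {p : ℝ × Bool} {q : ℝ} (hx : min 1 q ≤ x.cap)
    (hq : p.2 = true → q ≤ p.1) : min 1 q ≤ (x.step α j p).cap := by
  rcases x with a | c <;> rcases p with ⟨p, _ | _⟩
  · exact hx
  · exact min_le_min_left _ (hq rfl)
  · exact hx
  · exact le_min hx ((min_le_right _ _).trans (hq rfl))

theorem thr_unsold_add_mul_min (j : ℕ) (a p : ℝ) :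
    (unsold a).thr α j p + paymentRate α j * min a ((unsold a).thr α j p) = (j + 1) * p :=
  threshold_add_mul_min (paymentRate_nonneg j)

theorem le_thr (j : ℕ) (x : State) {p : ℝ} (hp : 0 ≤ p) : p ≤ x.thr α j p := by
  cases x with
  | sold c => exact le_rfl
  | unsold a =>
    have hw := paymentRate_nonneg (α := α) j
    have hj : (0 : ℝ) < j + 1 := by positivity
    refine le_of_mul_le_mul_left ?_ hj
    calc (j + 1) * p ≤ (1 + paymentRate α j) * (unsold a).thr α j p :=
          le_one_add_mul_threshold hw
      _ ≤ (j + 1) * (unsold a).thr α j p :=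
          mul_le_mul_of_nonneg_right (by linarith [paymentRate_le (α := α) j])
            (threshold_nonneg hw (by positivity))

protected theorem Valid.step {x : State} (hx : x.Valid) (j : ℕ) {p : ℝ} (hp : 0 ≤ p) (a : Bool) :
    (x.step α j (p, a)).Valid := by
  rcases x with b | c <;> cases a
  · exact ⟨nextTop_pos hx.1 _, (nextTop_le _ _).trans hx.2⟩
  · exact ⟨le_min zero_le_one hp, min_le_left _ _⟩
  · exact hx
  · exact ⟨le_min hx.1 hp, (min_le_left _ _).trans hx.2⟩

theorem Valid.price_nonneg {x : State} (hx : x.Valid) (m : ℕ) : 0 ≤ x.price α m := by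
  cases x with
  | sold c => exact hx.1
  | unsold a => exact mul_nonneg (div_nonneg (paymentRate_nonneg m) m.cast_nonneg) hx.1.le

theorem price_unsold_le {a : ℝ} (ha : 0 ≤ a) (m : ℕ) : (unsold a).price α m ≤ a :=
  mul_le_of_le_one_left ha (div_le_one_of_le₀ (paymentRate_le m) m.cast_nonneg)

theorem Valid.price_le_cap {x : State} (hx : x.Valid) (m : ℕ) : x.price α m ≤ x.cap := by
  cases x with
  | sold c => exact le_rfl
  | unsold a => exact (price_unsold_le hx.1.le m).trans hx.2

theorem mul_price_unsold (j : ℕ) (a : ℝ) :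
    (j + 1) * (unsold a).price α (j + 1) = (1 + paymentRate α j) * (thresholdRate α j * a) := by
  simp only [price, paymentRate_succ, Nat.cast_add_one]
  field_simp

theorem thr_price_unsold {a : ℝ} (ha : 0 ≤ a) (j : ℕ) :
    (unsold a).thr α j ((unsold a).price α (j + 1)) = thresholdRate α j * a := by
  rw [thr, mul_price_unsold]
  exact threshold_one_add_mul (paymentRate_nonneg j)
    (mul_le_of_le_one_left ha (thresholdRate_le_one j))

section Buyer

/-- The utility of the buyer of value `v` from the last `m` rounds if both players follow their
equilibrium strategies. -/
def utility (α : ℝ) : ℕ → State → ℝ → ℝ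
  | 0, _, _ => 0
  | j + 1, x, v =>
    max (v - x.price α (j + 1) + utility α j (x.step α j (x.price α (j + 1), true)) v)
      (utility α j (x.step α j (x.price α (j + 1), false)) v)

variable {m j : ℕ} {x : State} {a p v w : ℝ}

theorem utility_nonneg (m : ℕ) (x : State) (v : ℝ) : 0 ≤ utility α m x v := by
  induction m generalizing x with
  | zero => exact le_rfl
  | succ j ih => exact le_max_of_le_right (ih _)

theorem utility_sold (m : ℕ) (c v : ℝ) : utility α m (sold c) v = m * max (v - c) 0 := by
  induction m with
  | zero => simp [utility]
  | succ j ih =>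
    simp only [utility, price, step, min_self, ih]
    push_cast
    rcases le_total (v - c) 0 with h | h
    · rw [max_eq_right h, max_eq_right] <;> linarith
    · rw [max_eq_left h, max_eq_left] <;> linarith

theorem utility_le_add_mul_sub (hvw : v ≤ w) (m : ℕ) (x : State) :
    utility α m x w ≤ utility α m x v + m * (w - v) := by
  induction m generalizing x with
  | zero => simp [utility]
  | succ j ih =>
    have haccept := ih (x.step α j (x.price α (j + 1), true))
    have hreject := ih (x.step α j (x.price α (j + 1), false))
    rw [utility, utility, ← max_add_add_right]
    push_cast
    exact max_le_max (by linarith) (by linarith)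

theorem Valid.utility_zero (hx : x.Valid) (m : ℕ) : utility α m x 0 = 0 := by
  induction m generalizing x with
  | zero => rfl
  | succ j ih =>
    have hp := hx.price_nonneg (α := α) (j + 1)
    rw [utility, ih (hx.step j hp true), ih (hx.step j hp false), zero_sub, add_zero]
    exact max_eq_right (neg_nonpos.2 hp)

theorem utility_unsold_of_le (ha : 0 < a) (ha1 : a ≤ 1) (hv : a ≤ v) (m : ℕ) :
    utility α m (unsold a) v = m * v - paymentRate α m * a := by
  induction m generalizing a with
  | zero => simp [utility, paymentRate, rates]
  | succ j ih =>
    have hpa := price_unsold_le (α := α) ha.le (j + 1)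
    have hp := mul_price_unsold (α := α) j a
    have hθ := thr_price_unsold (α := α) ha.le j
    set p := (unsold a).price α (j + 1)
    set θ := thresholdRate α j * a
    have hθa : θ ≤ a := mul_le_of_le_one_left ha.le (thresholdRate_le_one j)
    have haccept : v - p + utility α j ((unsold a).step α j (p, true)) v = (j + 1) * (v - p) := by
      rw [step, utility_sold, min_eq_right (hpa.trans ha1),
        max_eq_left (sub_nonneg.2 (hpa.trans hv))]
      ring
    have hreject : utility α j ((unsold a).step α j (p, false)) v
        = j * v - paymentRate α j * nextTop a θ := by
      rw [step, hθ]
      exact ih (nextTop_pos ha θ) ((nextTop_le a θ).trans ha1) ((nextTop_le a θ).trans hv)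
    have hw := mul_le_mul_of_nonneg_left (le_nextTop hθa) (paymentRate_nonneg (α := α) j)
    have hpay : paymentRate α (j + 1) * a = (1 + paymentRate α j) * θ := by
      rw [paymentRate_succ, mul_assoc]
    rw [utility, haccept, hreject, hpay, max_eq_left (by linarith)]
    push_cast
    linarith

theorem utility_reject_thr (ha : 0 < a) (ha1 : a ≤ 1) (j : ℕ) (hp : 0 ≤ p) :
    utility α j ((unsold a).step α j (p, false)) ((unsold a).thr α j p)
      = (j + 1) * ((unsold a).thr α j p - p) := by
  have hpθ := le_thr (α := α) j (unsold a) hp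
  have hθ := thr_unsold_add_mul_min (α := α) j a p
  rw [step]
  set θ := (unsold a).thr α j p
  rcases (hp.trans hpθ).eq_or_lt with h0 | h0
  · have hvalid : (unsold (nextTop a θ)).Valid := ⟨nextTop_pos ha θ, (nextTop_le a θ).trans ha1⟩
    rw [← h0] at hpθ hvalid ⊢
    rw [hvalid.utility_zero, le_antisymm hpθ hp, sub_self, mul_zero]
  · -- After the rejection, no value in the seller's belief exceeds the threshold.
    rw [nextTop, if_pos h0, utility_unsold_of_le (lt_min ha h0) ((min_le_left a θ).trans ha1)
      (min_le_right a θ)]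
    linarith

theorem Valid.utility_reject_le (hx : x.Valid) (hp : 0 ≤ p) (hcap : min 1 p ≤ x.cap)
    (hv : v ≤ 1) (h : x.thr α j p ≤ v) :
    utility α j (x.step α j (p, false)) v ≤ v - p + utility α j (x.step α j (p, true)) v := by
  have hj : (0 : ℝ) ≤ j := j.cast_nonneg
  have hpv : p ≤ v := (le_thr j x hp).trans h
  rw [min_eq_right (hpv.trans hv)] at hcap
  cases x with
  | sold c =>
    have hmax : max (v - c) 0 ≤ v - p :=
      max_le (sub_le_sub_left hcap v) (sub_nonneg.2 hpv)
    simp only [step, utility_sold, min_eq_right (show p ≤ c from hcap),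
      max_eq_left (sub_nonneg.2 hpv)]
    linarith [mul_le_mul_of_nonneg_left hmax hj]
  | unsold a =>
    have hlip := utility_le_add_mul_sub (α := α) h j ((unsold a).step α j (p, false))
    rw [utility_reject_thr hx.1 hx.2 j hp] at hlip
    rw [show (unsold a).step α j (p, true) = sold (min 1 p) from rfl, utility_sold,
      min_eq_right (hpv.trans hv), max_eq_left (sub_nonneg.2 hpv)]
    linarith

theorem Valid.utility_accept_le (hx : x.Valid) (hp : 0 ≤ p) (hv : v ≤ 1) (h : v < x.thr α j p) :
    v - p + utility α j (x.step α j (p, true)) v ≤ utility α j (x.step α j (p, false)) v := by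
  have hreject := utility_nonneg (α := α) j (x.step α j (p, false)) v
  cases x with
  | sold c =>
    have hvp : v < p := h
    have hmax : max (v - min c p) 0 = max (v - c) 0 := by
      rcases le_total c p with hc | hc
      · rw [min_eq_left hc]
      · rw [min_eq_right hc, max_eq_right (by linarith), max_eq_right (by linarith)]
    simp only [step, utility_sold, hmax]
    linarith
  | unsold a =>
    have hlip := utility_le_add_mul_sub (α := α) h.le j ((unsold a).step α j (p, false))
    rw [utility_reject_thr hx.1 hx.2 j hp] at hlip
    rw [show (unsold a).step α j (p, true) = sold (min 1 p) from rfl, utility_sold]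
    rcases le_total v p with hvp | hpv
    · rw [max_eq_right (sub_nonpos.2 (le_min hv hvp))]
      linarith
    · rw [min_eq_right (hpv.trans hv), max_eq_left (sub_nonneg.2 hpv)]
      linarith

end Buyer

section Seller

/-- The seller's expected revenue from the last `m` rounds if both players follow their
equilibrium strategies. -/
def revenue (α : ℝ) (m : ℕ) : State → ℝ
  | unsold a => revenueRate α m * a
  | sold c => m * c

/-- The probability with which, according to the seller's belief, the buyer rejects the price `p`
when `j` rounds follow. -/
def rejectProb (α : ℝ) (j : ℕ) (p : ℝ) : State → ℝ
  | unsold a => (min a ((unsold a).thr α j p) / a) ^ α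
  | sold c => if p ≤ c then 0 else 1

/-- The seller's expected revenue from posting `p`, if `j` rounds follow in which both players
follow their equilibrium strategies. -/
def priceRevenue (α : ℝ) (j : ℕ) (p : ℝ) (x : State) : ℝ :=
  (1 - x.rejectProb α j p) * (p + (x.step α j (p, true)).revenue α j)
    + x.rejectProb α j p * (x.step α j (p, false)).revenue α j

variable {j : ℕ} {x : State} {a c p : ℝ}

theorem revenue_zero (x : State) : x.revenue α 0 = 0 := by
  cases x <;> simp [revenue, revenueRate, rates]

theorem Valid.revenue_nonneg (hx : x.Valid) (hα : 0 ≤ α) (m : ℕ) : 0 ≤ x.revenue α m := by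
  cases x with
  | unsold a => exact mul_nonneg (revenueRate_nonneg hα m) hx.1.le
  | sold c => exact mul_nonneg m.cast_nonneg hx.1

theorem priceRevenue_unsold (hα : 0 < α) (ha : 0 < a) (ha1 : a ≤ 1) (hp : 0 ≤ p) :
    (unsold a).priceRevenue α j p = scaledRevenue α (paymentRate α j) (revenueRate α j)
      (min a ((unsold a).thr α j p) / a) * a := by
  have hpθ := le_thr (α := α) j (unsold a) hp
  have hθ := thr_unsold_add_mul_min (α := α) j a p
  simp only [priceRevenue, rejectProb, step, revenue, scaledRevenue]
  set θ := (unsold a).thr α j p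
  rcases le_total a θ with h | h
  · rw [nextTop, if_pos (ha.trans_le h), min_eq_left h, div_self ha.ne', Real.one_rpow]
    ring
  rw [min_eq_right h] at hθ ⊢
  rw [min_eq_right (hpθ.trans (h.trans ha1))]
  rcases (hp.trans hpθ).eq_or_lt with h0 | h0
  · rw [← h0] at hpθ ⊢
    rw [le_antisymm hpθ hp, zero_div, Real.zero_rpow hα.ne']
    ring
  · rw [nextTop, if_pos h0, min_eq_right h]
    have hs : θ / a * a = θ := div_mul_cancel₀ θ ha.ne'
    set q := (θ / a) ^ α
    linear_combination (q - 1) * hθ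
      - ((1 + paymentRate α j) * (1 - q) + revenueRate α j * q) * hs

theorem Valid.priceRevenue_le (hx : x.Valid) (hα : 0 < α) (hp : 0 ≤ p) :
    x.priceRevenue α j p ≤ x.revenue α (j + 1) := by
  cases x with
  | unsold a =>
    rw [priceRevenue_unsold hα hx.1 hx.2 hp]
    have hθ : 0 ≤ min a ((unsold a).thr α j p) := le_min hx.1.le (hp.trans (le_thr j _ hp))
    exact mul_le_mul_of_nonneg_right (scaledRevenue_le_revenueRate_succ hα.le j
      ⟨div_nonneg hθ hx.1.le, div_le_one_of_le₀ (min_le_left _ _) hx.1.le⟩) hx.1.le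
  | sold c =>
    simp only [priceRevenue, rejectProb, step, revenue]
    push_cast
    split_ifs with h
    · rw [min_eq_right h]
      linarith [mul_le_mul_of_nonneg_left h (add_nonneg j.cast_nonneg (zero_le_one' ℝ))]
    · linarith [hx.1]

theorem Valid.priceRevenue_price (hx : x.Valid) (hα : 0 < α) (j : ℕ) :
    x.priceRevenue α j (x.price α (j + 1)) = x.revenue α (j + 1) := by
  cases x with
  | unsold a =>
    rw [priceRevenue_unsold hα hx.1 hx.2 (hx.price_nonneg _), thr_price_unsold hx.1.le,
      min_eq_right (mul_le_of_le_one_left hx.1.le (thresholdRate_le_one j)),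
      mul_div_cancel_right₀ _ hx.1.ne']
    rfl
  | sold c =>
    simp only [priceRevenue, rejectProb, price, step, revenue, le_refl, if_true, min_self]
    push_cast
    ring

end Seller

end State

section States

/-- The state after the history `h` of the game with `n` rounds. -/
def state (α : ℝ) (n : ℕ) : ∀ r : ℕ, Hist r → State
  | 0, _ => .unsold 1
  | r + 1, h => (state α n r (Fin.init h)).step α (n - (r + 1)) (h (Fin.last r))

/-- The threshold of the buyer after `h` when the price `p` has been posted. -/
def equilibriumThreshold (α : ℝ) (n r : ℕ) (h : Hist r) (p : ℝ) : ℝ :=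
  (state α n r h).thr α (n - (r + 1)) p

variable (α : ℝ) (n : ℕ) {r : ℕ}

theorem state_extend (r : ℕ) (h : Hist r) (p : ℝ) (a : Bool) :
    state α n (r + 1) (h.extend p a) = (state α n r h).step α (n - (r + 1)) (p, a) := by
  simp [state, Hist.extend]

theorem measurable_state (r : ℕ) : Measurable (state α n r) := by
  induction r with
  | zero => exact measurable_const
  | succ r ih =>
    have hinit : Measurable fun h : Hist (r + 1) => state α n r (Fin.init h) :=
      ih.comp (measurable_pi_lambda _ fun i => measurable_pi_apply _)
    exact (State.measurable_step (n - (r + 1))).comp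
      (hinit.prodMk (measurable_pi_apply (Fin.last r)))

theorem measurable_equilibriumThreshold (r : ℕ) :
    Measurable fun x : Hist r × ℝ => equilibriumThreshold α n r x.1 x.2 :=
  (State.measurable_thr (n - (r + 1))).comp ((measurable_state α n r).prodMap measurable_id)

theorem Hist.Feasible.valid_state {h : Hist r} (hf : h.Feasible) : (state α n r h).Valid := by
  induction r with
  | zero => exact ⟨zero_lt_one, le_rfl⟩
  | succ r ih => exact (ih hf.init).step _ (hf _).1 _

theorem cap_state_le_of_accepted {h : Hist r} {i : Fin r} (hi : (h i).2 = true) :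
    (state α n r h).cap ≤ (h i).1 := by
  induction r with
  | zero => exact i.elim0
  | succ r ih =>
    induction i using Fin.lastCases with
    | last =>
      rw [state, show h (Fin.last r) = ((h (Fin.last r)).1, true) from Prod.ext rfl hi]
      exact State.cap_step_true_le ..
    | cast i => exact (State.cap_step_le ..).trans (ih (h := Fin.init h) hi)

theorem min_one_le_cap_state {h : Hist r} {p : ℝ} (hp : p ∈ h.allowed) :
    min 1 p ≤ (state α n r h).cap := by
  induction r with
  | zero => exact min_le_left _ _
  | succ r ih =>
    exact State.min_one_le_cap_step
      (ih (h := Fin.init h) ⟨hp.1, fun i hi => hp.2 i.castSucc hi⟩) (hp.2 (Fin.last r))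

theorem Hist.Feasible.price_state_mem_allowed {h : Hist r} (hf : h.Feasible) (m : ℕ) :
    (state α n r h).price α m ∈ h.allowed :=
  ⟨(hf.valid_state α n).price_nonneg m, fun _ hi =>
    ((hf.valid_state α n).price_le_cap m).trans (cap_state_le_of_accepted α n hi)⟩

end States

section Beliefs

/-- What the seller believes about the buyer's value in a given state, if the prior is `F`. -/
def State.IsBelief (F ν : Measure ℝ) : State → Prop
  | unsold a => ν = F[|Set.Iio a]
  | sold c => ∀ᵐ v ∂ν, c ≤ v

variable {α : ℝ} {F ν : Measure ℝ}

theorem cond_measureReal_Iio (hF : ∀ x ∈ unitInterval, F.real (Set.Iio x) = x ^ α) {a θ : ℝ}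
    (ha : 0 < a) (ha1 : a ≤ 1) (hθ : 0 ≤ θ) :
    F[|Set.Iio a].real (Set.Iio θ) = (min a θ / a) ^ α := by
  have hmin : 0 ≤ min a θ := le_min ha.le hθ
  rw [measureReal_def, cond_apply measurableSet_Iio, Set.Iio_inter_Iio, ENNReal.toReal_mul,
    ENNReal.toReal_inv, ← measureReal_def, ← measureReal_def, hF a ⟨ha.le, ha1⟩,
    hF _ ⟨hmin, (min_le_left _ _).trans ha1⟩, Real.div_rpow hmin ha.le, div_eq_inv_mul]

theorem update_cond_Iio [IsFiniteMeasure F] (hα : α ≠ 0)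
    (hF : ∀ x ∈ unitInterval, F.real (Set.Iio x) = x ^ α) {a θ : ℝ} (ha : 0 < a) (ha1 : a ≤ 1)
    (hθ : 0 ≤ θ) : update F[|Set.Iio a] θ false = F[|Set.Iio (nextTop a θ)] := by
  have hreject : F[|Set.Iio a] (Set.Iio θ) = 0 ↔ θ = 0 := by
    rw [← measureReal_eq_zero_iff, cond_measureReal_Iio hF ha ha1 hθ,
      Real.rpow_eq_zero (div_nonneg (le_min ha.le hθ) ha.le) hα, div_eq_zero_iff]
    constructor
    · rintro (h | h)
      · rcases min_choice a θ with h' | h' <;> linarith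
      · linarith
    · rintro rfl
      exact .inl (min_eq_right ha.le)
  rw [update, responseSet, nextTop]
  rcases hθ.eq_or_lt with rfl | hθ
  · simp [hreject.2 rfl]
  · rw [if_neg (hreject.not.2 hθ.ne'), if_pos hθ,
      cond_cond_eq_cond_inter measurableSet_Iio measurableSet_Iio, Set.Iio_inter_Iio]

theorem ae_le_update_true {t c : ℝ} (hc : c ≤ 1) (hct : c ≤ t) :
    ∀ᵐ v ∂(update ν t true), c ≤ v := by
  simp only [update, if_true]
  split_ifs
  · rwa [ae_dirac_eq]
  · exact ae_cond_of_forall_mem (measurableSet_responseSet t true) fun v hv => hct.trans hv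

variable {x : State}

theorem State.IsBelief.measureReal_Iio_thr (hν : x.IsBelief F ν) (hx : x.Valid)
    [IsProbabilityMeasure ν] (hνs : ∀ᵐ v ∂ν, v ∈ valueSpace)
    (hF : ∀ x ∈ unitInterval, F.real (Set.Iio x) = x ^ α) (j : ℕ) {p : ℝ} (hp : 0 ≤ p)
    (hcap : min 1 p ≤ x.cap) : ν.real (Set.Iio (x.thr α j p)) = x.rejectProb α j p := by
  cases x with
  | unsold a =>
    rw [show ν = F[|Set.Iio a] from hν,
      cond_measureReal_Iio hF hx.1 hx.2 (hp.trans (le_thr j _ hp)), rejectProb]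
  | sold c =>
    simp only [thr, rejectProb]
    split_ifs with h
    · rw [measureReal_eq_zero_iff, measure_eq_zero_iff_ae_notMem]
      filter_upwards [hν] with v hv using not_lt.2 (h.trans hv)
    · have h1 : 1 < p := by
        by_contra! h1
        exact h (by rwa [min_eq_right h1] at hcap)
      have hνp : ∀ᵐ v ∂ν, v < p := hνs.mono fun v hv => hv.2.trans_lt h1
      rw [measureReal_def, (mem_ae_iff_prob_eq_one measurableSet_Iio).1 hνp, ENNReal.toReal_one]

theorem State.IsBelief.update [IsFiniteMeasure F] (hν : x.IsBelief F ν) (hx : x.Valid)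
    (hα : α ≠ 0) (hF : ∀ x ∈ unitInterval, F.real (Set.Iio x) = x ^ α) (j : ℕ) {p : ℝ} (hp : 0 ≤ p)
    (a : Bool) : (x.step α j (p, a)).IsBelief F (update ν (x.thr α j p) a) := by
  have hpθ := le_thr (α := α) j x hp
  rcases x with b | c
  · obtain rfl : ν = F[|Set.Iio b] := hν
    cases a
    · exact update_cond_Iio hα hF hx.1 hx.2 (hp.trans hpθ)
    · exact ae_le_update_true (min_le_left 1 p) ((min_le_right 1 p).trans hpθ)
  · have hc := ae_update_of_ae (P := (c ≤ ·)) hν hx.2 p a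
    cases a
    · exact hc
    · exact hc.mono fun v hv => (min_le_left c p).trans hv

theorem ae_mem_Ico_of_measureReal_Iio [IsProbabilityMeasure F] (hα : α ≠ 0)
    (hF : ∀ x ∈ unitInterval, F.real (Set.Iio x) = x ^ α) : ∀ᵐ v ∂F, v ∈ Set.Ico (0 : ℝ) 1 := by
  have hneg : ∀ᵐ v ∂F, v ∉ Set.Iio (0 : ℝ) := by
    rw [← measure_eq_zero_iff_ae_notMem, ← measureReal_eq_zero_iff, hF 0 unitInterval.zero_mem,
      Real.zero_rpow hα]
  have hlt : ∀ᵐ v ∂F, v ∉ (Set.Iio (1 : ℝ))ᶜ := by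
    rw [← measure_eq_zero_iff_ae_notMem, ← measureReal_eq_zero_iff,
      probReal_compl_eq_one_sub measurableSet_Iio, hF 1 unitInterval.one_mem, Real.one_rpow,
      sub_self]
  filter_upwards [hneg, hlt] with v h0 h1 using ⟨not_lt.1 h0, not_not.1 h1⟩

theorem Hist.Feasible.isBelief_posterior [IsProbabilityMeasure F] (hα : α ≠ 0)
    (hF : ∀ x ∈ unitInterval, F.real (Set.Iio x) = x ^ α) (n : ℕ) {r : ℕ} {h : Hist r}
    (hf : h.Feasible) :
    (state α n r h).IsBelief F (posterior F (equilibriumThreshold α n) r h) := by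
  induction r with
  | zero =>
    have hlt : ∀ᵐ v ∂F, v ∈ Set.Iio (1 : ℝ) :=
      (ae_mem_Ico_of_measureReal_Iio hα hF).mono fun v hv => hv.2
    change F = F[|Set.Iio 1]
    rw [ProbabilityTheory.cond, Measure.restrict_eq_self_of_ae_mem hlt,
      (mem_ae_iff_prob_eq_one measurableSet_Iio).1 hlt, inv_one, one_smul]
  | succ r ih =>
    exact (ih hf.init).update (hf.init.valid_state α n) hα hF _ (hf (Fin.last r)).1 _

end Beliefs

section Equilibrium

/-- The seller's strategy in the equilibrium of the game with `n` rounds. -/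
def equilibriumSeller (α : ℝ) (n : ℕ) : SellerStrategy where
  price r := Kernel.deterministic (fun h => (state α n r h).price α (n - r))
    ((State.measurable_price (n - r)).comp (measurable_state α n r))
  isMarkov _ := inferInstance
  allowed r h hf := by
    rw [Kernel.deterministic_apply, ae_dirac_eq]
    exact hf.price_state_mem_allowed α n (n - r)

/-- The buyer's strategy in the equilibrium of the game with `n` rounds. -/
def equilibriumBuyer (α : ℝ) (n : ℕ) : BuyerStrategy :=
  thresholdStrategy (equilibriumThreshold α n) (measurable_equilibriumThreshold α n)

variable {α : ℝ} {n r : ℕ} {h : Hist r} {p : ℝ}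

theorem isThreshold_equilibriumBuyer (α : ℝ) (n : ℕ) : (equilibriumBuyer α n).IsThreshold n :=
  isThreshold_thresholdStrategy fun _ _ _ _ _ hp => hp.1.trans (State.le_thr _ _ hp.1)

theorem lintegral_equilibriumSeller (f : ℝ → ℝ≥0∞) :
    ∫⁻ p, f p ∂((equilibriumSeller α n).price r h) = f ((state α n r h).price α (n - r)) := by
  rw [equilibriumSeller, Kernel.deterministic_apply, lintegral_dirac]

theorem stageRevenue_equilibriumBuyer {F : Measure ℝ} [IsProbabilityMeasure F] (hα : 0 < α)
    (hF : ∀ x ∈ unitInterval, F.real (Set.Iio x) = x ^ α) (hf : h.Feasible)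
    (hp : p ∈ h.allowed) :
    stageRevenue (equilibriumBuyer α n) (posterior F (equilibriumThreshold α n) r h) r h p
        (fun a => ENNReal.ofReal
          ((state α n (r + 1) (h.extend p a)).revenue α (n - (r + 1))))
      = ENNReal.ofReal ((state α n r h).priceRevenue α (n - (r + 1)) p) := by
  have hx := hf.valid_state α n
  have := isProbabilityMeasure_posterior (F := F) (t := equilibriumThreshold α n) r h
  have hsupport : ∀ᵐ v ∂(posterior F (equilibriumThreshold α n) r h), v ∈ valueSpace :=
    ae_posterior_of_ae ((ae_mem_Ico_of_measureReal_Iio hα.ne' hF).mono Set.Ico_subset_Icc_self)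
      ⟨zero_le_one, le_rfl⟩ r h
  have hreject := (hf.isBelief_posterior hα.ne' hF n).measureReal_Iio_thr hx hsupport hF
    (n - (r + 1)) hp.1 (min_one_le_cap_state α n hp)
  simp only [state_extend]
  rw [equilibriumBuyer, stageRevenue_thresholdStrategy _ r h hp.1
    fun a => (hx.step _ hp.1 a).revenue_nonneg hα.le _, equilibriumThreshold, hreject]
  rfl

theorem isSellerValue_equilibrium {F : Measure ℝ} [IsProbabilityMeasure F] (hα : 0 < α)
    (hF : ∀ x ∈ unitInterval, F.real (Set.Iio x) = x ^ α) (n : ℕ) :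
    IsSellerValue n (equilibriumSeller α n) (equilibriumBuyer α n)
      (posterior F (equilibriumThreshold α n))
      (fun r h => ENNReal.ofReal ((state α n r h).revenue α (n - r))) where
  final h := by
    rw [Nat.sub_self, State.revenue_zero, ENNReal.ofReal_zero]
  stageRevenue_le r hr h hf p hp := by
    rw [stageRevenue_equilibriumBuyer hα hF hf hp, show n - r = n - (r + 1) + 1 by lia]
    exact ENNReal.ofReal_le_ofReal ((hf.valid_state α n).priceRevenue_le hα hp.1)
  lintegral_stageRevenue r hr h hf := by
    rw [lintegral_equilibriumSeller, stageRevenue_equilibriumBuyer hα hF hf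
      (hf.price_state_mem_allowed α n _), show n - r = n - (r + 1) + 1 by lia,
      (hf.valid_state α n).priceRevenue_price hα]

theorem isBuyerValue_equilibrium (α : ℝ) (n : ℕ) {v : ℝ} (hv : v ∈ valueSpace) :
    IsBuyerValue n (equilibriumSeller α n) (equilibriumBuyer α n) v
      (fun r h => ENNReal.ofReal ((state α n r h).utility α (n - r) v)) where
  final h := by simp [State.utility]
  of_accept r _ h hf p hp ha := by
    have hθ : equilibriumThreshold α n r h p ≤ v := by
      by_contra hθ
      exact ha (if_neg hθ)
    have := (hf.valid_state α n).utility_reject_le hp.1 (min_one_le_cap_state α n hp) hv.2 hθ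
    rw [state_extend, state_extend, ← ENNReal.ofReal_add (State.utility_nonneg ..) hp.1,
      ← ENNReal.ofReal_add hv.1 (State.utility_nonneg ..)]
    exact ENNReal.ofReal_le_ofReal (by linarith)
  of_reject r _ h hf p hp ha := by
    have hθ : v < equilibriumThreshold α n r h p := by
      by_contra! hθ
      exact ha (if_pos hθ)
    have := (hf.valid_state α n).utility_accept_le hp.1 hv.2 hθ
    rw [state_extend, state_extend, ← ENNReal.ofReal_add (State.utility_nonneg ..) hp.1,
      ← ENNReal.ofReal_add hv.1 (State.utility_nonneg ..)]
    exact ENNReal.ofReal_le_ofReal (by linarith)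
  lintegral_stageUtility r hr h hf := by
    have hp := (hf.valid_state α n).price_nonneg (α := α) (n - r)
    rw [lintegral_equilibriumSeller, stageUtility, state_extend, state_extend,
      ← ENNReal.ofReal_add hv.1 (State.utility_nonneg ..), ← ENNReal.ofReal_sub _ hp,
      ← ENNReal.ofReal_max, show n - r = n - (r + 1) + 1 by lia, State.utility, sub_add_eq_add_sub]

end Equilibrium

section PowerLaw

theorem ae_powerLaw_mem_Icc (k : ℕ) : ∀ᵐ v ∂(powerLaw k), v ∈ Set.Icc (0 : ℝ) 1 :=
  (withDensity_absolutelyContinuous _ _).ae_le (ae_restrict_mem measurableSet_Icc)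

theorem powerLaw_Icc (k : ℕ) {x : ℝ} (hx : x ∈ unitInterval) :
    powerLaw k (Set.Icc 0 x) = ENNReal.ofReal (x ^ (k + 1)) := by
  have hcont : Continuous fun y : ℝ => ((k : ℝ) + 1) * y ^ k := by fun_prop
  rw [powerLaw, withDensity_apply _ measurableSet_Icc, Measure.restrict_restrict measurableSet_Icc,
    Set.inter_eq_left.2 (Set.Icc_subset_Icc_right hx.2),
    Measure.restrict_congr_set Ioc_ae_eq_Icc.symm, ← ofReal_integral_eq_lintegral_ofReal,
    ← intervalIntegral.integral_of_le hx.1, intervalIntegral.integral_const_mul, integral_pow]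
  · congr 1
    field_simp
    simp
  · exact (hcont.intervalIntegrable 0 x).1
  · filter_upwards [ae_restrict_mem measurableSet_Ioc] with y hy
    have := hy.1.le
    positivity

theorem powerLaw_Iio (k : ℕ) {x : ℝ} (hx : x ∈ unitInterval) :
    powerLaw k (Set.Iio x) = ENNReal.ofReal (x ^ (k + 1)) := by
  have hatom : powerLaw k {x} = 0 :=
    ((withDensity_absolutelyContinuous _ _).trans
      Measure.restrict_le_self.absolutelyContinuous) Real.volume_singleton
  have hIio : Set.Iio x =ᵐ[powerLaw k] Set.Icc 0 x := by
    filter_upwards [ae_powerLaw_mem_Icc k, measure_eq_zero_iff_ae_notMem.1 hatom] with v hv hvx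
    exact propext ⟨fun h => ⟨hv.1, le_of_lt h⟩, fun h => h.2.lt_of_ne hvx⟩
  rw [measure_congr hIio, powerLaw_Icc k hx]

instance (k : ℕ) : IsProbabilityMeasure (powerLaw k) where
  measure_univ := by
    calc powerLaw k Set.univ = powerLaw k (Set.Icc 0 1) :=
          (measure_congr (Filter.eventuallyEq_univ.2 (ae_powerLaw_mem_Icc k))).symm
      _ = 1 := by simpa only [one_pow, ENNReal.ofReal_one] using powerLaw_Icc k unitInterval.one_mem

theorem powerLaw_real_Iio (k : ℕ) {x : ℝ} (hx : x ∈ unitInterval) :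
    (powerLaw k).real (Set.Iio x) = x ^ ((k : ℝ) + 1) := by
  rw [measureReal_def, powerLaw_Iio k hx, ENNReal.toReal_ofReal (pow_nonneg hx.1 _)]
  exact_mod_cast (Real.rpow_natCast x (k + 1)).symm

end PowerLaw

end

end RepeatedSales

open RepeatedSales in
theorem theorem2_general {α : ℝ} (hα : 0 < α) (F : Measure ℝ) [IsProbabilityMeasure F]
    (hF : ∀ x ∈ unitInterval, F.real (Set.Iio x) = x ^ α) (n : ℕ) :
    ∃ (s : SellerStrategy) (b : BuyerStrategy) (μ : ∀ r : ℕ, Hist r → Measure ℝ),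
      IsPBE n F s b μ ∧ b.IsThreshold n := by
  have hvalue : ∀ᵐ v ∂F, v ∈ valueSpace :=
    (ae_mem_Ico_of_measureReal_Iio hα.ne' hF).mono Set.Ico_subset_Icc_self
  exact ⟨equilibriumSeller α n, equilibriumBuyer α n, posterior F (equilibriumThreshold α n),
    isPBE_of_isSellerValue_of_isBuyerValue (isConsistent_posterior hvalue n)
      (isSellerValue_equilibrium hα hF n) fun v hv => isBuyerValue_equilibrium α n hv,
    isThreshold_equilibriumBuyer α n⟩

theorem theorem2 (k n : ℕ) :
    ∃ (s : RepeatedSales.SellerStrategy) (b : RepeatedSales.BuyerStrategy)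
      (μ : ∀ r : ℕ, RepeatedSales.Hist r → MeasureTheory.Measure ℝ),
      RepeatedSales.IsPBE n (RepeatedSales.powerLaw k) s b μ ∧ b.IsThreshold n :=
  theorem2_general (by positivity) (RepeatedSales.powerLaw k)
    (fun _ => RepeatedSales.powerLaw_real_Iio k) n
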